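/- Let $G=(V,E)$ be a connected simple graph embedded in the plane (vertices are distinct points; edges are simple arcs joining their end vertices, passing through no other vertex, and meeting one another only at common end vertices), and suppose that $G$ is locally finite in the sense that every compact subset of the plane contains only finitely many vertices of $G$. A cycle $\mathcal C$ of $G$ *surrounds* a vertex or a cycle if the latter lies in the bounded part of the plane that remains after deleting (the curve of) $\mathcal C$. Suppose that $G$ is *choked*: for every vertex $v$ there are a positive integer $N=N(v)$ and a sequence of cycles $(\mathcal C_n)_{n\in\mathbb N}$ of $G$ such that, for every $n$, the cycle $\mathcal C_n$ surrounds $v$, fewer than $N$ edges of $G$ lie on $\mathcal C_n$ or touch a vertex of $\mathcal C_n$, and $\mathcal C_{n+1}$ surrounds $\mathcal C_n$. Let the couplings $\mathcal J=(J_e)_{e\in E}$ be independent and identically distributed with a law on $\mathbb R$ that is symmetric, continuous (has no atoms) and whose support is all of $\mathbb R$. A configuration $\sigma\in\{-1,1\}^V$ is a *ground state* for $\mathcal J$ if flipping any finite set of spins does not lower the energy $-\sum_{\{x,y\}\in E}J_{xy}\sigma_x\sigma_y$, that is, if $$\sum_{\{x,y\}\in\partial A}J_{xy}\sigma_x\sigma_y\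 \ge\ 0\qquad\text{for every finite } A\subseteq V,$$ where $\partial A$ is the set of edges between $A$ and $V\setminus A$ (a finite set, as all degrees of a choked graph are finite). A *ground-state pair* is a set $\{\sigma,-\sigma\}$ with $\sigma$ a ground state. Then, with probability $1$, there is exactly one ground-state pair for $\mathcal J$ on $G$. -/

import Mathlib

namespace SpinGlass

/-- The Euclidean plane. -/
abbrev Plane : Type := EuclideanSpace ℝ (Fin 2)

/-- An embedding of a simple graph in the plane: vertices are distinct points, every edge is a simple
arc joining its two end vertices, an arc passes through no vertex other than its end vertices, and two
different arcs can meet only in vertices (hence only in common end vertices). -/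
structure PlaneEmbedding {V : Type*} (G : SimpleGraph V) where
  point : V → Plane
  arc : G.edgeSet → Set Plane
  point_injective : Function.Injective point
  arc_isSimple : ∀ (x y : V) (h : G.Adj x y), ∃ γ : Path (point x) (point y),
    Function.Injective γ ∧ Set.range γ = arc ⟨s(x, y), h⟩
  mem_of_point_mem_arc : ∀ (e : G.edgeSet) (v : V), point v ∈ arc e → v ∈ (e : Sym2 V)
  arc_inter_subset : ∀ e f : G.edgeSet, e ≠ f → arc e ∩ arc f ⊆ Set.range point

/-- The bounded part of the plane after deletion of the set `C`: the points off `C` whose connected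
component in the complement of `C` is bounded. -/
def inside (C : Set Plane) : Set Plane :=
  {x | x ∉ C ∧ Bornology.IsBounded (connectedComponentIn Cᶜ x)}

/-- `C` surrounds `S` if `S` lies in the bounded part of the plane after deletion of `C`. -/
def Surrounds (C S : Set Plane) : Prop := S ⊆ inside C

namespace PlaneEmbedding

variable {V : Type*} {G : SimpleGraph V}

/-- Every compact subset of the plane contains at most finitely many vertices. -/
def LocallyFinite (φ : PlaneEmbedding G) : Prop :=
  ∀ K : Set Plane, IsCompact K → {v : V | φ.point v ∈ K}.Finite

/-- The plane curve traced by a walk: the union of the arcs of its edges. -/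
def curve (φ : PlaneEmbedding G) {u w : V} (c : G.Walk u w) : Set Plane :=
  ⋃ e ∈ {e : G.edgeSet | (e : Sym2 V) ∈ c.edges}, φ.arc e

end PlaneEmbedding

/-- The edges of `G` which lie on the walk `c` or touch a vertex of `c`. -/
def touchingEdges {V : Type*} {G : SimpleGraph V} {u w : V} (c : G.Walk u w) : Set (Sym2 V) :=
  {e | e ∈ G.edgeSet ∧ (e ∈ c.edges ∨ ∃ x ∈ c.support, x ∈ e)}

/-- The closed walk `c` is a cycle which `N`-chokes the vertex `v`. -/
def Chokes {V : Type*} {G : SimpleGraph V} (φ : PlaneEmbedding G) (N : ℕ) (v : V) {u : V}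
    (c : G.Walk u u) : Prop :=
  c.IsCycle ∧ Surrounds (φ.curve c) {φ.point v} ∧ (touchingEdges c).encard < (N : ℕ∞)

/-- The locally finite plane graph `G`, embedded by `φ`, is choked. -/
def IsChoked {V : Type*} {G : SimpleGraph V} (φ : PlaneEmbedding G) : Prop :=
  φ.LocallyFinite ∧
    ∀ v : V, ∃ N : ℕ, 0 < N ∧ ∃ (u : ℕ → V) (c : (n : ℕ) → G.Walk (u n) (u n)),
      (∀ n, Chokes φ N v (c n)) ∧
      ∀ n, Surrounds (φ.curve (c (n + 1))) (φ.curve (c n))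

/-- A spin configuration: a choice of `1` or `-1` at every vertex. -/
abbrev Configuration (V : Type*) : Type _ := V → ℤˣ

/-- The product of the spins at the two ends of an edge. -/
def spinProduct {V : Type*} (σ : Configuration V) (e : Sym2 V) : ℤˣ :=
  Sym2.lift ⟨fun x y => σ x * σ y, fun x y => mul_comm (σ x) (σ y)⟩ e

/-- The value `J_{xy} σ_x σ_y` of an edge. -/
def value {V : Type*} {G : SimpleGraph V} (J : G.edgeSet → ℝ) (σ : Configuration V)
    (e : G.edgeSet) : ℝ :=
  J e * ((spinProduct σ (e : Sym2 V) : ℤ) : ℝ)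

/-- The edges between the vertex set `A` and its complement. -/
def edgeBoundary {V : Type*} (G : SimpleGraph V) (A : Set V) : Set G.edgeSet :=
  {e | (∃ x ∈ A, x ∈ (e : Sym2 V)) ∧ ∃ y ∉ A, y ∈ (e : Sym2 V)}

/-- `σ` is a ground state for the couplings `J`: flipping the spins of a finite set `A` of vertices
changes the energy by twice the sum of the values of the boundary edges of `A`, and this never lowers
the energy. (The sum is a genuine finite sum whenever all degrees of `G` are finite, which holds
for every choked graph.) -/
def IsGroundState {V : Type*} (G : SimpleGraph V) (J : G.edgeSet → ℝ) (σ : Configuration V) : Prop :=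
  ∀ A : Set V, A.Finite → 0 ≤ ∑ᶠ e ∈ edgeBoundary G A, value J σ e

/-- A ground-state pair: a ground state together with its global spin flip. -/
def IsGroundStatePair {V : Type*} (G : SimpleGraph V) (J : G.edgeSet → ℝ)
    (p : Set (Configuration V)) : Prop :=
  ∃ σ : Configuration V, IsGroundState G J σ ∧ p = {σ, -σ}

end SpinGlass

/-! ### Planar topology: the region inside a compact curve. -/

namespace SpinGlass

open Set Bornology

/-! Existence holds for all couplings, by compactness of `{-1,1}^V` applied to finite-volume
minimizers (`exists_isGroundState`). For uniqueness, take every second nested cycle around a vertex: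
their sets of touching edges are disjoint and of bounded size. By Borel-Cantelli, almost surely some
cycle is strong: its own couplings exceed 1 and all others touching it are below `1 / N` in absolute
value (`ae_exists_strong`). Flipping the minus spins on a strong cycle would lower the energy unless
the cycle is monochromatic, so all ground states are constant on it (`eq_start_of_strong`) and any
two agree there up to a global sign. Almost surely no signed finite sum of couplings vanishes
(`ae_isNonresonant`). If two ground states agree on a cycle, the boundary sum of their disagreement
set inside is both nonnegative and nonpositive, hence zero, hence empty (`eq_of_eqOn_support`). Were
`τ ≠ ±σ`, connectedness would give an edge joining agreement to disagreement, and a strong cycle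
around it excludes this (`eq_or_eq_neg`). -/

theorem not_isBounded_connectedComponentIn_of_ray {C : Set Plane} {x : Plane} (hx : x ≠ 0)
    (h : ∀ t : ℝ, 1 ≤ t → t • x ∉ C) : ¬ IsBounded (connectedComponentIn Cᶜ x) := by
  intro hb
  have hpre : IsPreconnected ((fun t : ℝ => t • x) '' Ici 1) :=
    isPreconnected_Ici.image _ (by fun_prop)
  have hsub : (fun t : ℝ => t • x) '' Ici 1 ⊆ connectedComponentIn Cᶜ x := by
    refine hpre.subset_connectedComponentIn ⟨1, by simp, by simp⟩ ?_
    rintro _ ⟨t, ht, rfl⟩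
    exact h t ht
  obtain ⟨R, hR⟩ := (hb.subset hsub).exists_norm_le
  have hn : 0 < ‖x‖ := norm_pos_iff.2 hx
  have h1 : (1 : ℝ) ≤ 1 + |R| / ‖x‖ := by
    have : 0 ≤ |R| / ‖x‖ := by positivity
    linarith
  have h2 := hR _ ⟨_, h1, rfl⟩
  simp only [norm_smul, Real.norm_eq_abs] at h2
  rw [abs_of_pos (by linarith), add_mul, div_mul_cancel₀ _ hn.ne'] at h2
  linarith [le_abs_self R]

theorem isBounded_inside {C : Set Plane} (hC : IsBounded C) : IsBounded (inside C) := by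
  obtain ⟨R, hR0, hR⟩ := hC.exists_pos_norm_le
  refine isBounded_iff_forall_norm_le.2 ⟨R, fun x hx => ?_⟩
  by_contra! hlt
  have hx0 : 0 < ‖x‖ := hR0.trans hlt
  refine not_isBounded_connectedComponentIn_of_ray (norm_pos_iff.1 hx0) (fun t ht hmem => ?_) hx.2
  have := hR _ hmem
  rw [norm_smul, Real.norm_eq_abs, abs_of_nonneg (by linarith)] at this
  nlinarith

/-- Two compact sets cannot surround each other: consider a point of largest norm. -/
theorem not_surrounds_of_surrounds {C D : Set Plane} (hC : IsCompact C) (hC0 : C.Nonempty)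
    (hD : IsCompact D) (hD0 : D.Nonempty) (hCD : Surrounds D C) : ¬ Surrounds C D := by
  intro hDC
  have key : ∀ {A B : Set Plane}, A ⊆ inside B → B.Nonempty → ∀ p ∈ A,
      ¬ ∀ q ∈ A ∪ B, ‖q‖ ≤ ‖p‖ := by
    intro A B hAB ⟨b, hb⟩ p hp hmax
    have hpB : p ∉ B := (hAB hp).1
    have hp0 : p ≠ 0 := by
      rintro rfl
      have := hmax b (Or.inr hb)
      rw [norm_zero, norm_le_zero_iff] at this
      exact hpB (this ▸ hb)
    refine not_isBounded_connectedComponentIn_of_ray hp0 (fun t ht hmem => ?_) (hAB hp).2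
    have h1 := hmax _ (Or.inr hmem)
    rw [norm_smul, Real.norm_eq_abs, abs_of_nonneg (by linarith)] at h1
    have hn : 0 < ‖p‖ := norm_pos_iff.2 hp0
    have : t = 1 := le_antisymm (by nlinarith) ht
    rw [this, one_smul] at hmem
    exact hpB hmem
  obtain ⟨p, hp, hmax⟩ := (hC.union hD).exists_isMaxOn (hC0.mono subset_union_left)
    continuous_norm.continuousOn
  rcases hp with hp | hp
  · exact key hCD hD0 p hp hmax
  · exact key hDC hC0 p hp (by rwa [union_comm])

/-- A component of `Dᶜ` either meets `C`, hence is bounded because `D` surrounds `C`, or misses `C`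
and lies in a component of `Cᶜ`. If `D` itself entered `inside C`, connectedness would put all of it
there, and the two sets would surround each other. -/
theorem inside_subset_inside {C D : Set Plane} (hC : IsCompact C) (hC0 : C.Nonempty)
    (hD : IsCompact D) (hDc : IsPreconnected D) (h : Surrounds D C) :
    inside C ⊆ inside D := by
  intro x hx
  by_cases hxD : x ∈ D
  · exfalso
    refine not_surrounds_of_surrounds hC hC0 hD ⟨x, hxD⟩ h fun y hy => ?_
    have hDC : D ⊆ Cᶜ := fun z hz hzC => (h hzC).1 hz
    have hyx := hDc.subset_connectedComponentIn hxD hDC hy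
    exact ⟨hDC hy, connectedComponentIn_eq hyx ▸ hx.2⟩
  · refine ⟨hxD, ?_⟩
    by_contra hb
    by_cases hL : ∃ p ∈ connectedComponentIn Dᶜ x, p ∈ C
    · obtain ⟨p, hp, hpC⟩ := hL
      rw [connectedComponentIn_eq hp] at hb
      exact hb (h hpC).2
    · push Not at hL
      exact hb (hx.2.subset (isPreconnected_connectedComponentIn.subset_connectedComponentIn
        (mem_connectedComponentIn hxD) hL))

/-! ### Curves of walks in an embedded graph. -/

namespace PlaneEmbedding

variable {V : Type*} {G : SimpleGraph V}

theorem arc_properties (φ : PlaneEmbedding G) (e : G.edgeSet) :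
    IsCompact (φ.arc e) ∧ IsPreconnected (φ.arc e) ∧
      ∀ v ∈ (e : Sym2 V), φ.point v ∈ φ.arc e := by
  obtain ⟨e, he⟩ := e
  induction e using Sym2.ind with
  | _ x y =>
    obtain ⟨γ, -, hγ⟩ := φ.arc_isSimple x y he
    rw [← hγ]
    refine ⟨isCompact_range γ.continuous, isPreconnected_range γ.continuous, fun v hv => ?_⟩
    rcases Sym2.mem_iff.1 hv with rfl | rfl
    · exact ⟨0, γ.source⟩
    · exact ⟨1, γ.target⟩

theorem isCompact_curve (φ : PlaneEmbedding G) {u w : V} (c : G.Walk u w) :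
    IsCompact (φ.curve c) := by
  refine Set.Finite.isCompact_biUnion ?_ fun e _ => (φ.arc_properties e).1
  exact (c.edges.finite_toSet).preimage Subtype.val_injective.injOn

theorem curve_cons (φ : PlaneEmbedding G) {u v w : V} (h : G.Adj u v) (c : G.Walk v w) :
    φ.curve (c.cons h) = φ.arc ⟨s(u, v), h⟩ ∪ φ.curve c := by
  ext p
  simp only [curve, SimpleGraph.Walk.edges_cons, List.mem_cons, mem_ofPred_eq, mem_iUnion,
    exists_prop, mem_union]
  constructor
  · rintro ⟨e, he | he, hp⟩
    · left
      have : e = ⟨s(u, v), h⟩ := Subtype.ext he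
      exact this ▸ hp
    · exact Or.inr ⟨e, he, hp⟩
  · rintro (hp | ⟨e, he, hp⟩)
    · exact ⟨_, Or.inl rfl, hp⟩
    · exact ⟨e, Or.inr he, hp⟩

/-- Inserting the starting point lets the induction begin at the trivial walk, whose curve is empty.
-/
theorem isPreconnected_insert_curve (φ : PlaneEmbedding G) {u w : V} (c : G.Walk u w) :
    IsPreconnected (insert (φ.point u) (φ.curve c)) ∧
      ∀ x ∈ c.support, φ.point x ∈ insert (φ.point u) (φ.curve c) := by
  induction c with
  | nil => simp [curve, isPreconnected_singleton]
  | @cons u v w h c ih =>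
    have ha := φ.arc_properties ⟨s(u, v), h⟩
    have hu := ha.2.2 u (Sym2.mem_mk_left _ _)
    have hv := ha.2.2 v (Sym2.mem_mk_right _ _)
    have heq : insert (φ.point u) (φ.curve (c.cons h)) =
        φ.arc ⟨s(u, v), h⟩ ∪ insert (φ.point v) (φ.curve c) := by
      rw [curve_cons]
      ext p
      simp only [mem_insert_iff, mem_union]
      constructor
      · rintro (rfl | hp | hp) <;> tauto
      · rintro (hp | rfl | hp) <;> tauto
    rw [heq]
    refine ⟨ha.2.1.union (φ.point v) hv (mem_insert _ _) ih.1, fun x hx => ?_⟩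
    rw [SimpleGraph.Walk.support_cons, List.mem_cons] at hx
    rcases hx with rfl | hx
    · exact Or.inl hu
    · exact Or.inr (ih.2 x hx)

theorem point_mem_curve (φ : PlaneEmbedding G) {u w : V} {c : G.Walk u w} (hc : ¬ c.Nil) {x : V}
    (hx : x ∈ c.support) : φ.point x ∈ φ.curve c := by
  rcases (φ.isPreconnected_insert_curve c).2 x hx with h | h
  · rw [h]
    cases c with
    | nil => simp at hc
    | cons h c =>
      rw [curve_cons]
      exact Or.inl ((φ.arc_properties _).2.2 _ (Sym2.mem_mk_left _ _))
  · exact h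

theorem isPreconnected_curve (φ : PlaneEmbedding G) {u w : V} {c : G.Walk u w} (hc : ¬ c.Nil) :
    IsPreconnected (φ.curve c) := by
  have := (φ.isPreconnected_insert_curve c).1
  rwa [insert_eq_of_mem (φ.point_mem_curve hc c.start_mem_support)] at this

/-- A neighbour of a vertex inside a closed curve lies on the curve or inside it. -/
theorem mem_support_or_mem_inside_of_adj (φ : PlaneEmbedding G) {u w : V} {c : G.Walk u w}
    (hc : ¬ c.Nil) {x y : V} (hx : φ.point x ∈ inside (φ.curve c)) (hxy : G.Adj x y) :
    y ∈ c.support ∨ φ.point y ∈ inside (φ.curve c) := by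
  by_cases hy : y ∈ c.support
  · exact Or.inl hy
  right
  have ha := φ.arc_properties ⟨s(x, y), hxy⟩
  have hxs : x ∉ c.support := fun h => hx.1 (φ.point_mem_curve hc h)
  have hsub : φ.arc ⟨s(x, y), hxy⟩ ⊆ (φ.curve c)ᶜ := by
    intro p hp hpc
    simp only [curve, mem_iUnion, mem_ofPred_eq, exists_prop] at hpc
    obtain ⟨f, hf, hpf⟩ := hpc
    have hne : (⟨s(x, y), hxy⟩ : G.edgeSet) ≠ f := by
      rintro rfl
      exact hxs (c.fst_mem_support_of_mem_edges hf)
    obtain ⟨z, rfl⟩ := φ.arc_inter_subset _ _ hne ⟨hp, hpf⟩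
    have hzs : z ∈ c.support :=
      SimpleGraph.Walk.mem_support_of_mem_edges hf (φ.mem_of_point_mem_arc _ _ hpf)
    rcases Sym2.mem_iff.1 (φ.mem_of_point_mem_arc _ _ hp) with rfl | rfl
    · exact hxs hzs
    · exact hy hzs
  have hmem := ha.2.1.subset_connectedComponentIn (ha.2.2 x (Sym2.mem_mk_left _ _)) hsub
    (ha.2.2 y (Sym2.mem_mk_right _ _))
  exact ⟨hsub (ha.2.2 y (Sym2.mem_mk_right _ _)), connectedComponentIn_eq hmem ▸ hx.2⟩

theorem LocallyFinite.countable {φ : PlaneEmbedding G} (h : φ.LocallyFinite) : Countable V := by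
  rw [← countable_univ_iff]
  have : (univ : Set V) ⊆ ⋃ n : ℕ, {v | φ.point v ∈ Metric.closedBall (0 : Plane) n} := by
    intro v _
    obtain ⟨n, hn⟩ := exists_nat_ge ‖φ.point v‖
    exact mem_iUnion.2 ⟨n, by simpa using hn⟩
  exact (countable_iUnion fun n => (h _ (isCompact_closedBall _ _)).countable).mono this

theorem LocallyFinite.finite_inside {φ : PlaneEmbedding G} (h : φ.LocallyFinite) {u w : V}
    (c : G.Walk u w) : {v | φ.point v ∈ inside (φ.curve c)}.Finite := by
  obtain ⟨R, hR⟩ := (isBounded_inside (φ.isCompact_curve c).isBounded).exists_norm_le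
  exact (h _ (isCompact_closedBall 0 R)).subset fun v hv => by simpa using hR _ hv

end PlaneEmbedding

variable {V : Type*} {G : SimpleGraph V} {φ : PlaneEmbedding G}

/-- All neighbours of `x` lie on or inside one cycle surrounding `x`, where there are only finitely
many vertices. -/
theorem IsChoked.finite_neighborSet (hφ : IsChoked φ) (x : V) : (G.neighborSet x).Finite := by
  obtain ⟨N, -, u, c, hc, -⟩ := hφ.2 x
  refine ((c 0).support.finite_toSet.union (hφ.1.finite_inside (c 0))).subset fun y hy => ?_
  exact φ.mem_support_or_mem_inside_of_adj (hc 0).1.not_nil ((hc 0).2.1 rfl) hy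

theorem finite_edgeBoundary (hG : ∀ x, (G.neighborSet x).Finite) {A : Set V} (hA : A.Finite) :
    (edgeBoundary G A).Finite := by
  refine Set.Finite.of_finite_image (f := Subtype.val) ?_ Subtype.val_injective.injOn
  refine (hA.biUnion fun x _ => (hG x).image fun y => s(x, y)).subset ?_
  rintro _ ⟨⟨e, he⟩, ⟨⟨x, hxA, hx⟩, -⟩, rfl⟩
  obtain ⟨y, rfl⟩ := Sym2.mem_iff_exists.1 hx
  exact mem_biUnion hxA ⟨y, he, rfl⟩

theorem mem_touchingEdges_iff {u w : V} {c : G.Walk u w} {e : Sym2 V} :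
    e ∈ touchingEdges c ↔ e ∈ G.edgeSet ∧ ∃ x ∈ c.support, x ∈ e := by
  refine and_congr_right fun _ => ⟨?_, Or.inr⟩
  rintro (h | h)
  · exact ⟨_, SimpleGraph.Walk.mem_support_of_mem_edges h (Sym2.out_fst_mem e), Sym2.out_fst_mem e⟩
  · exact h

/-! ### Nested sequences of cycles. -/

section Nested

variable {u : ℕ → V} {c : (n : ℕ) → G.Walk (u n) (u n)}

theorem surrounds_of_lt (hc : ∀ n, ¬ (c n).Nil)
    (h : ∀ n, Surrounds (φ.curve (c (n + 1))) (φ.curve (c n))) {m n : ℕ} (hmn : m < n) :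
    Surrounds (φ.curve (c n)) (φ.curve (c m)) := by
  induction n, hmn using Nat.le_induction with
  | base => exact h m
  | succ n _ ih =>
    exact ih.trans (inside_subset_inside (φ.isCompact_curve _)
      ⟨_, φ.point_mem_curve (hc n) (c n).start_mem_support⟩
      (φ.isCompact_curve _) (φ.isPreconnected_curve (hc _)) (h n))

/-- No edge touches two nested cycles which are separated by a third one. -/
theorem disjoint_touchingEdges (hc : ∀ n, ¬ (c n).Nil)
    (h : ∀ n, Surrounds (φ.curve (c (n + 1))) (φ.curve (c n))) {m n : ℕ} (hmn : m + 1 < n) :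
    Disjoint (touchingEdges (c m)) (touchingEdges (c n)) := by
  refine Set.disjoint_left.2 fun e hem hen => ?_
  obtain ⟨he, x, hx, hxe⟩ := mem_touchingEdges_iff.1 hem
  obtain ⟨-, y, hy, hye⟩ := mem_touchingEdges_iff.1 hen
  have hxin := h m (φ.point_mem_curve (hc m) hx)
  have hyc := φ.point_mem_curve (hc n) hy
  have hsur := surrounds_of_lt hc h hmn
  by_cases hxy : x = y
  · subst hxy
    exact (surrounds_of_lt hc h (m.lt_succ_self.trans hmn) (φ.point_mem_curve (hc m) hx)).1 hyc
  · obtain rfl := (Sym2.mem_and_mem_iff hxy).1 ⟨hxe, hye⟩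
    -- From cycle `m` an edge reaches no further than cycle `m + 1`, which is still strictly inside
    -- cycle `n`.
    rcases φ.mem_support_or_mem_inside_of_adj (hc _) hxin he with h1 | h1
    · exact (hsur (φ.point_mem_curve (hc _) h1)).1 hyc
    · exact (inside_subset_inside (φ.isCompact_curve _)
        ⟨_, φ.point_mem_curve (hc (m + 1)) (c (m + 1)).start_mem_support⟩
        (φ.isCompact_curve _) (φ.isPreconnected_curve (hc _)) hsur h1).1 hyc

end Nested

end SpinGlass

/-! ### Probability: absence of cancellations and Borel-Cantelli. -/

namespace SpinGlass

open MeasureTheory ProbabilityTheory Filter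
open scoped ENNReal

variable {ι : Type*} (μ : Measure ℝ) [IsProbabilityMeasure μ]

/-- A nontrivial linear combination of independent couplings without atoms vanishes with
probability zero. -/
theorem ae_sum_mul_ne_zero [NullSingletonClass μ] (F : Finset ι) (a : ι → ℝ) {i : ι} (hi : i ∈ F)
    (ha : a i ≠ 0) :
    ∀ᵐ J ∂(Measure.infinitePi (fun _ : ι => μ)), ∑ j ∈ F, a j * J j ≠ 0 := by
  classical
  set P := Measure.infinitePi (fun _ : ι => μ)
  set f : ι → (ι → ℝ) → ℝ := fun j J => a j * J j
  have hf : ∀ j, Measurable (f j) := fun j => by fun_prop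
  have hind : iIndepFun f P :=
    iIndepFun_infinitePi (P := fun _ : ι => μ) (X := fun j x => a j * x) (fun j => by fun_prop)
  have hI := hind.indepFun_finsetSum_of_notMem hf (Finset.notMem_erase i F)
  have hS : Measurable (∑ j ∈ F.erase i, f j) := by
    rw [Finset.sum_fn]
    exact Finset.measurable_sum _ fun j _ => hf j
  have hprod := hI.map_prod_eq_prod_map_map hS.aemeasurable (hf i).aemeasurable
  have hset : MeasurableSet {p : ℝ × ℝ | p.1 + p.2 = 0} :=
    (measurable_fst.add measurable_snd) (measurableSet_singleton 0)
  have hmap : P.map (f i) = μ.map (fun x => a i * x) := by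
    have : f i = (fun x => a i * x) ∘ fun J => J i := rfl
    rw [this, ← Measure.map_map (by fun_prop) (by fun_prop), Measure.infinitePi_map_eval]
  have : IsProbabilityMeasure (P.map (f i)) := Measure.isProbabilityMeasure_map (hf i).aemeasurable
  -- Fubini: once the other terms sum to `s`, the coupling `J i` must hit the single point `-s / a
  -- i`.
  have hnull : (P.map (∑ j ∈ F.erase i, f j)).prod (P.map (f i)) {p : ℝ × ℝ | p.1 + p.2 = 0} = 0 := by
    rw [Measure.measure_prod_null hset]
    refine Eventually.of_forall fun s => ?_
    change P.map (f i) (Prod.mk s ⁻¹' {p : ℝ × ℝ | p.1 + p.2 = 0}) = 0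
    have : Prod.mk s ⁻¹' {p : ℝ × ℝ | p.1 + p.2 = 0} = {-s} := by
      ext t
      simp only [Set.mem_preimage, Set.mem_ofPred_eq, Set.mem_singleton_iff]
      constructor <;> intro h <;> linarith
    rw [this, hmap, Measure.map_apply (by fun_prop) (measurableSet_singleton _)]
    have : (fun x => a i * x) ⁻¹' {-s} = {-s / a i} := by
      ext t
      simp only [Set.mem_preimage, Set.mem_singleton_iff]
      rw [eq_div_iff ha, mul_comm]
    rw [this]
    exact measure_singleton _
  rw [← hprod, Measure.map_apply (hS.prodMk (hf i)) hset] at hnull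
  refine measure_mono_null (fun J hJ => ?_) hnull
  simp only [Set.mem_compl_iff, Set.mem_ofPred_eq, not_not] at hJ
  simp only [Set.mem_preimage, Set.mem_ofPred_eq, Finset.sum_apply, f]
  rwa [Finset.sum_erase_add _ _ hi]

/-- Independent events about disjoint sets of at most `N` coordinates, each coordinate event having
probability at least `p > 0`: almost surely one of them occurs. -/
theorem ae_exists_forall_mem (F : ℕ → Finset ι) (hF : Pairwise fun m n => Disjoint (F m) (F n))
    {N : ℕ} (hN : ∀ n, (F n).card ≤ N) {p : ℝ≥0∞} (hp : p ≠ 0) (T : ι → Set ℝ)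
    (hT : ∀ i, MeasurableSet (T i)) (hpT : ∀ i, p ≤ μ (T i)) :
    ∀ᵐ J ∂(Measure.infinitePi (fun _ : ι => μ)), ∃ n, ∀ i ∈ F n, J i ∈ T i := by
  classical
  set P := Measure.infinitePi (fun _ : ι => μ)
  let E : ℕ → Set (ι → ℝ) := fun n => (F n : Set ι).pi T
  have hE : ∀ n, MeasurableSet (E n) := fun n =>
    MeasurableSet.pi (F n).countable_toSet fun i _ => hT i
  have hPE : ∀ s : Finset ι, P ((s : Set ι).pi T) = ∏ i ∈ s, μ (T i) := fun s =>
    Measure.infinitePi_pi _ fun i _ => hT i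
  have hind : iIndepSet E P := by
    rw [iIndepSet_iff_meas_biInter hE]
    intro s
    have : ⋂ n ∈ s, E n = ((s.biUnion F : Finset ι) : Set ι).pi T := by
      ext J
      simp only [E, Set.mem_iInter, Set.mem_pi, Finset.mem_coe, Finset.mem_biUnion]
      exact ⟨fun h i ⟨n, hn, hi⟩ => h n hn i hi, fun h n hn i hi => h i ⟨n, hn, hi⟩⟩
    rw [this, hPE, Finset.prod_biUnion fun m _ n _ hmn => hF hmn]
    exact Finset.prod_congr rfl fun n _ => (hPE _).symm
  -- Truncating at 1 makes powers decrease in the exponent; `p ≤ 1` would not follow from `hpT` if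
  -- `ι` were empty.
  have hle : ∀ n, min p 1 ^ N ≤ P (E n) := fun n => by
    rw [hPE]
    calc min p 1 ^ N ≤ min p 1 ^ (F n).card := pow_le_pow_right_of_le_one' (min_le_right _ _) (hN n)
      _ = ∏ i ∈ F n, min p 1 := by rw [Finset.prod_const]
      _ ≤ _ := Finset.prod_le_prod' fun i _ => (min_le_left _ _).trans (hpT i)
  have hsum : ∑' n, P (E n) = ∞ := by
    refine top_unique ?_
    rw [← ENNReal.tsum_const_eq_top_of_ne_zero (α := ℕ) (c := min p 1 ^ N)
      (pow_ne_zero _ (by simp [hp, min_eq_iff]))]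
    exact ENNReal.tsum_le_tsum hle
  have h1 := measure_limsup_eq_one hE hind hsum
  have h2 : ∀ᵐ J ∂P, J ∈ limsup E atTop :=
    (prob_compl_eq_zero_iff₀ (MeasurableSet.measurableSet_limsup hE).nullMeasurableSet).2 h1
  filter_upwards [h2] with J hJ
  obtain ⟨n, hn⟩ := (mem_limsup_iff_frequently_mem.1 hJ).exists
  exact ⟨n, fun i hi => hn i hi⟩

end SpinGlass

/-! ### Uniqueness of the ground-state pair. -/

namespace SpinGlass

open Set MeasureTheory
open scoped ENNReal

variable {V : Type*} {G : SimpleGraph V}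

@[simp]
theorem spinProduct_mk (σ : Configuration V) (x y : V) : spinProduct σ s(x, y) = σ x * σ y := rfl

theorem spinProduct_neg (σ : Configuration V) (e : Sym2 V) :
    spinProduct (-σ) e = spinProduct σ e := by
  induction e using Sym2.ind with
  | _ x y => simp

theorem IsGroundState.neg {J : G.edgeSet → ℝ} {σ : Configuration V} (h : IsGroundState G J σ) :
    IsGroundState G J (-σ) := by
  intro A hA
  simpa only [value, spinProduct_neg] using h A hA

theorem eq_neg_of_ne {a b : ℤˣ} (h : a ≠ b) : a = -b := by
  rcases Int.units_eq_one_or a with rfl | rfl <;> rcases Int.units_eq_one_or b with rfl | rfl <;>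
    simp_all

theorem mem_edgeBoundary_mk {A : Set V} {x y : V} (h : G.Adj x y) :
    (⟨s(x, y), h⟩ : G.edgeSet) ∈ edgeBoundary G A ↔ (x ∈ A ∧ y ∉ A) ∨ (y ∈ A ∧ x ∉ A) := by
  simp only [edgeBoundary, mem_ofPred_eq, Sym2.mem_iff]
  constructor
  · rintro ⟨⟨a, ha, rfl | rfl⟩, b, hb, rfl | rfl⟩ <;> tauto
  · rintro (⟨ha, hb⟩ | ⟨ha, hb⟩)
    · exact ⟨⟨x, ha, Or.inl rfl⟩, y, hb, Or.inr rfl⟩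
    · exact ⟨⟨y, ha, Or.inr rfl⟩, x, hb, Or.inl rfl⟩

theorem exists_eq_mk_of_mem_edgeBoundary {A : Set V} {e : G.edgeSet} (he : e ∈ edgeBoundary G A) :
    ∃ (x y : V) (h : G.Adj x y), x ∈ A ∧ y ∉ A ∧ e = ⟨s(x, y), h⟩ := by
  obtain ⟨e, hG⟩ := e
  obtain ⟨⟨x, hxA, hx⟩, y, hyA, hy⟩ := he
  have hxy : x ≠ y := fun h => hyA (h ▸ hxA)
  obtain rfl := (Sym2.mem_and_mem_iff hxy).1 ⟨hx, hy⟩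
  exact ⟨x, y, hG, hxA, hyA, rfl⟩

theorem abs_value (J : G.edgeSet → ℝ) (σ : Configuration V) (e : G.edgeSet) :
    |value J σ e| = |J e| := by
  rcases Int.units_eq_one_or (spinProduct σ (e : Sym2 V)) with h | h <;> simp [value, h]

/-- Spins agree along a walk as soon as they agree across each of its edges. -/
theorem eq_start_of_forall_mem_edges {u w : V} (c : G.Walk u w) (σ : Configuration V)
    (h : ∀ x y, s(x, y) ∈ c.edges → σ x = σ y) : ∀ x ∈ c.support, σ x = σ u := by
  induction c with
  | nil => simp
  | @cons u v w huv c ih =>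
    intro x hx
    rw [SimpleGraph.Walk.support_cons, List.mem_cons] at hx
    rcases hx with rfl | hx
    · rfl
    · have h1 : σ u = σ v := h u v (by simp)
      rw [h1]
      exact ih (fun a b hab => h a b (by simp [hab])) x hx

/-- If the couplings on a closed walk are large and positive and all other couplings touching it are
small, every ground state is constant on it. -/
theorem IsGroundState.eq_start_of_strong {u w : V} {c : G.Walk u w} {J : G.edgeSet → ℝ} {N : ℕ}
    (hN : 0 < N) {F : Finset G.edgeSet} (hF : ∀ e : G.edgeSet, e ∈ F ↔ (e : Sym2 V) ∈ touchingEdges c)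
    (hcard : F.card ≤ N) (hstrong : ∀ e ∈ F, (e : Sym2 V) ∈ c.edges → 1 < J e)
    (hweak : ∀ e ∈ F, (e : Sym2 V) ∉ c.edges → |J e| < 1 / N)
    {σ : Configuration V} (hσ : IsGroundState G J σ) : ∀ x ∈ c.support, σ x = σ u := by
  classical
  refine eq_start_of_forall_mem_edges c σ fun a b hab => ?_
  by_contra hne
  have hN' : (0 : ℝ) < N := by exact_mod_cast hN
  -- Flipping the minus spins of the walk: each walk edge in the boundary of `A` contributes less
  -- than `-1`, and the edge `s(a, b)` is one of them, while the other terms sum to at most `N * (1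
  -- / N) = 1`.
  set A : Set V := {x | x ∈ c.support ∧ σ x = -1}
  have hA : A.Finite := c.support.finite_toSet.subset fun x hx => hx.1
  have hsub : edgeBoundary G A ⊆ (F : Set G.edgeSet) := by
    intro e he
    obtain ⟨x, hx, hxe⟩ := he.1
    exact (hF e).2 (mem_touchingEdges_iff.2 ⟨e.2, x, hx.1, hxe⟩)
  set B : Finset G.edgeSet := F.filter (· ∈ edgeBoundary G A)
  have hB : (B : Set G.edgeSet) = edgeBoundary G A := by
    ext e
    simpa [B] using fun h => hsub h
  have hsum := hσ A hA
  rw [← hB, finsum_mem_coe_finset] at hsum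
  have hcyc : ∀ e ∈ B, (e : Sym2 V) ∈ c.edges → value J σ e < -1 := by
    intro e he hec
    obtain ⟨heF, heA⟩ := Finset.mem_filter.1 he
    have hJ := hstrong e heF hec
    obtain ⟨x, y, hxy, hx, hy, rfl⟩ := exists_eq_mk_of_mem_edgeBoundary heA
    have hys : y ∈ c.support := c.snd_mem_support_of_mem_edges hec
    have hy1 : σ y = 1 := by
      rcases Int.units_eq_one_or (σ y) with h | h
      · exact h
      · exact absurd ⟨hys, h⟩ hy
    simp only [value, spinProduct_mk, hx.2, hy1]
    simp
    linarith
  have hle : ∀ e ∈ B, value J σ e ≤ 1 / N := by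
    intro e he
    by_cases hec : (e : Sym2 V) ∈ c.edges
    · have : (0 : ℝ) < 1 / N := by positivity
      linarith [hcyc e he hec]
    · exact (le_abs_self _).trans
        ((abs_value J σ e).trans_le (hweak e (Finset.mem_filter.1 he).1 hec).le)
  have hadj : G.Adj a b := c.adj_of_mem_edges hab
  have has := c.fst_mem_support_of_mem_edges hab
  have hbs := c.snd_mem_support_of_mem_edges hab
  have heB : (⟨s(a, b), hadj⟩ : G.edgeSet) ∈ B := by
    rw [← Finset.mem_coe, hB, mem_edgeBoundary_mk]
    rcases Int.units_eq_one_or (σ a) with h1 | h1 <;>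
      rcases Int.units_eq_one_or (σ b) with h2 | h2 <;> simp_all [A]
  have h1 := hcyc _ heB hab
  rw [← Finset.add_sum_erase _ _ heB] at hsum
  have h2 : ∑ e ∈ B.erase ⟨s(a, b), hadj⟩, value J σ e ≤ N * (1 / N : ℝ) := by
    calc _ ≤ ∑ e ∈ B.erase ⟨s(a, b), hadj⟩, (1 / N : ℝ) :=
          Finset.sum_le_sum fun e he => hle e (Finset.mem_of_mem_erase he)
      _ = (B.erase ⟨s(a, b), hadj⟩).card * (1 / N : ℝ) := by rw [Finset.sum_const, nsmul_eq_mul]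
      _ ≤ _ := by
        gcongr
        exact (Finset.card_le_card ((Finset.erase_subset _ _).trans
          (Finset.filter_subset _ _))).trans hcard
  rw [mul_one_div_cancel hN'.ne'] at h2
  linarith

/-- No signed sum of finitely many couplings vanishes. -/
def IsNonresonant {ι : Type*} [DecidableEq ι] (J : ι → ℝ) : Prop :=
  ∀ F S : Finset ι, F.Nonempty → ∑ e ∈ F, (if e ∈ S then 1 else -1) * J e ≠ 0

theorem ae_isNonresonant {ι : Type*} [DecidableEq ι] [Countable ι] (μ : Measure ℝ)
    [IsProbabilityMeasure μ] [NullSingletonClass μ] :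
    ∀ᵐ J ∂(Measure.infinitePi (fun _ : ι => μ)), IsNonresonant J := by
  refine ae_all_iff.2 fun F => ae_all_iff.2 fun S => ?_
  by_cases hF : F.Nonempty
  · obtain ⟨i, hi⟩ := hF
    filter_upwards [ae_sum_mul_ne_zero μ F (fun e => if e ∈ S then 1 else -1) hi
      (by split_ifs <;> norm_num)] with J hJ _ using hJ
  · exact Filter.Eventually.of_forall fun J h => absurd h hF

/-- For nonresonant couplings, two ground states which agree on a closed curve also agree inside
it, at least at the vertices having a neighbour where they agree. -/
theorem IsGroundState.eq_of_eqOn_support [DecidableEq G.edgeSet] {φ : PlaneEmbedding G}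
    (hφ : φ.LocallyFinite) (hG : ∀ x, (G.neighborSet x).Finite)
    {J : G.edgeSet → ℝ} (hJ : IsNonresonant J) {σ τ : Configuration V} (hσ : IsGroundState G J σ)
    (hτ : IsGroundState G J τ) {u w : V} {c : G.Walk u w} (hc : ¬ c.Nil)
    (hst : ∀ x ∈ c.support, σ x = τ x) {x y : V} (hxy : G.Adj x y)
    (hx : φ.point x ∈ inside (φ.curve c)) (hy : σ y = τ y) : σ x = τ x := by
  by_contra hne
  set A : Set V := {z | φ.point z ∈ inside (φ.curve c) ∧ σ z ≠ τ z}
  have hA : A.Finite := (hφ.finite_inside c).subset fun z hz => hz.1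
  have hfin := finite_edgeBoundary hG hA
  -- A boundary edge of `A` has exactly one end where `σ` and `τ` differ.
  have hopp : ∀ e ∈ edgeBoundary G A, value J τ e = - value J σ e := by
    intro e he
    obtain ⟨a, b, hab, ha, hb, rfl⟩ := exists_eq_mk_of_mem_edgeBoundary he
    have hb' : σ b = τ b := by
      rcases φ.mem_support_or_mem_inside_of_adj hc ha.1 hab with h | h
      · exact hst b h
      · by_contra h'
        exact hb ⟨h, h'⟩
    simp [value, eq_neg_of_ne ha.2, hb']
  have h1 := hσ A hA
  have h2 := hτ A hA
  rw [finsum_mem_eq_finite_toFinset_sum _ hfin] at h1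
  rw [finsum_mem_congr rfl hopp, finsum_mem_eq_finite_toFinset_sum _ hfin,
    Finset.sum_neg_distrib] at h2
  have h0 := le_antisymm (neg_nonneg.1 h2) h1
  have hmem : (⟨s(x, y), hxy⟩ : G.edgeSet) ∈ edgeBoundary G A :=
    (mem_edgeBoundary_mk hxy).2 (Or.inl ⟨⟨hx, hne⟩, fun h => h.2 hy⟩)
  refine hJ hfin.toFinset (hfin.toFinset.filter fun e => spinProduct σ (e : Sym2 V) = 1)
    ⟨_, hfin.mem_toFinset.2 hmem⟩ (Eq.trans (Finset.sum_congr rfl fun e he => ?_) h0)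
  rcases Int.units_eq_one_or (spinProduct σ (e : Sym2 V)) with h | h <;>
    simp [value, h, Finset.mem_filter, he]

/-- For nonresonant couplings for which every vertex is surrounded by a cycle on which all
ground states are constant, there is at most one ground-state pair. -/
theorem IsGroundState.eq_or_eq_neg [DecidableEq G.edgeSet] (hG : G.Connected) {φ : PlaneEmbedding G}
    (hφ : φ.LocallyFinite) (hfin : ∀ x, (G.neighborSet x).Finite)
    {J : G.edgeSet → ℝ} (hJ : IsNonresonant J)
    (hc : ∀ v, ∃ (u : V) (c : G.Walk u u), ¬ c.Nil ∧ φ.point v ∈ inside (φ.curve c) ∧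
      ∀ σ, IsGroundState G J σ → ∀ x ∈ c.support, σ x = σ u)
    {σ τ : Configuration V} (hσ : IsGroundState G J σ) (hτ : IsGroundState G J τ) :
    τ = σ ∨ τ = -σ := by
  by_contra! h
  obtain ⟨z, hz⟩ := Function.ne_iff.1 h.1
  obtain ⟨w, hw⟩ := Function.ne_iff.1 h.2
  have hw' : σ w = τ w := by
    by_contra h'
    exact hw (by rw [Pi.neg_apply, eq_neg_of_ne h', neg_neg])
  obtain ⟨p⟩ := hG.preconnected z w
  obtain ⟨d, -, hd1, hd2⟩ := p.exists_boundary_dart {x | σ x ≠ τ x} hz.symm (by simpa using hw')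
  set x := d.fst
  set y := d.snd
  have hxy : G.Adj x y := d.adj
  have hx : σ x ≠ τ x := hd1
  have hy : σ y = τ y := by simpa using hd2
  obtain ⟨u, c, hnil, hin, hconst⟩ := hc x
  by_cases hu : σ u = τ u
  · refine hx (hσ.eq_of_eqOn_support hφ hfin hJ hτ hnil (fun v hv => ?_) hxy hin hy)
    rw [hconst σ hσ v hv, hconst τ hτ v hv, hu]
  -- On the cycle `σ` now agrees with `-τ`, so `x` and `y` exchange roles; `y` is strictly inside,
  -- since `σ y = τ y`.
  · have hon : ∀ v ∈ c.support, σ v = (-τ) v := fun v hv => by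
      rw [hconst σ hσ v hv, Pi.neg_apply, hconst τ hτ v hv]
      exact eq_neg_of_ne hu
    have hyin : φ.point y ∈ inside (φ.curve c) := by
      refine (φ.mem_support_or_mem_inside_of_adj hnil hin hxy).resolve_left fun hys => hu ?_
      rw [← hconst σ hσ y hys, ← hconst τ hτ y hys, hy]
    have := hσ.eq_of_eqOn_support hφ hfin hJ hτ.neg hnil hon hxy.symm hyin (eq_neg_of_ne hx)
    rw [hy, Pi.neg_apply] at this
    exact units_ne_neg_self _ this

/-- Almost surely every vertex of a choked graph is surrounded by a cycle on which all ground states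
are constant. -/
theorem IsChoked.ae_exists_strong {φ : PlaneEmbedding G} (hφ : IsChoked φ) (μ : Measure ℝ)
    [IsProbabilityMeasure μ] [μ.IsOpenPosMeasure] (v : V) :
    ∀ᵐ J ∂(Measure.infinitePi (fun _ : G.edgeSet => μ)),
      ∃ (u : V) (c : G.Walk u u), ¬ c.Nil ∧ φ.point v ∈ inside (φ.curve c) ∧
        ∀ σ, IsGroundState G J σ → ∀ x ∈ c.support, σ x = σ u := by
  classical
  obtain ⟨N, hN, u, c, hc, hsur⟩ := hφ.2 v
  have hnil : ∀ n, ¬ (c n).Nil := fun n => (hc n).1.not_nil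
  have hN' : (0 : ℝ) < N := by exact_mod_cast hN
  have hfin : ∀ n, ((Subtype.val : G.edgeSet → Sym2 V) ⁻¹' touchingEdges (c n)).Finite := fun n =>
    (finite_of_encard_le_coe (hc n).2.2.le).preimage Subtype.val_injective.injOn
  -- Consecutive cycles may share touching edges; cycles two steps apart do not.
  let F : ℕ → Finset G.edgeSet := fun n => (hfin (2 * n)).toFinset
  have hF : ∀ n (e : G.edgeSet), e ∈ F n ↔ (e : Sym2 V) ∈ touchingEdges (c (2 * n)) := by
    simp [F]
  have hdisj : Pairwise fun m n => Disjoint (F m) (F n) := by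
    have key : ∀ m n, m < n → Disjoint (F m) (F n) := fun m n hmn => by
      rw [Finset.disjoint_left]
      intro e hm hn
      exact Set.disjoint_left.1 (disjoint_touchingEdges hnil hsur (m := 2 * m) (n := 2 * n)
        (by omega)) ((hF _ _).1 hm) ((hF _ _).1 hn)
    intro m n hmn
    rcases hmn.lt_or_gt with h | h
    · exact key m n h
    · exact (key n m h).symm
  have hcard : ∀ n, (F n).card ≤ N := fun n => by
    have h1 : ((F n : Set G.edgeSet)).encard ≤ N := by
      have : (F n : Set G.edgeSet) = Subtype.val ⁻¹' touchingEdges (c (2 * n)) := by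
        simp [F]
      rw [this, ← Subtype.val_injective.encard_image]
      exact (encard_le_encard (image_preimage_subset _ _)).trans (hc _).2.2.le
    rw [encard_coe_eq_coe_finsetCard] at h1
    exact_mod_cast h1
  -- The target set of an edge must not depend on `n`. This is harmless: by disjointness, an edge in
  -- `F n` lies on no other even-indexed cycle.
  let T : G.edgeSet → Set ℝ := fun e =>
    if ∃ n, (e : Sym2 V) ∈ (c (2 * n)).edges then Ioi 1 else Ioo (-(1 / N : ℝ)) (1 / N)
  have hpos : (0 : ℝ) < 1 / N := by positivity
  have hT : ∀ e, MeasurableSet (T e) := fun e => by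
    dsimp only [T]
    split_ifs
    exacts [measurableSet_Ioi, measurableSet_Ioo]
  have hp : min (μ (Ioi 1)) (μ (Ioo (-(1 / N : ℝ)) (1 / N))) ≠ 0 := by
    have h1 : μ (Ioi 1) ≠ 0 := (isOpen_Ioi.measure_pos μ nonempty_Ioi).ne'
    have h2 : μ (Ioo (-(1 / N : ℝ)) (1 / N)) ≠ 0 :=
      (isOpen_Ioo.measure_pos μ (nonempty_Ioo.2 (by linarith))).ne'
    rcases min_choice (μ (Ioi 1)) (μ (Ioo (-(1 / N : ℝ)) (1 / N))) with h | h <;> rwa [h]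
  have hpT : ∀ e, min (μ (Ioi 1)) (μ (Ioo (-(1 / N : ℝ)) (1 / N))) ≤ μ (T e) := fun e => by
    dsimp only [T]
    split_ifs
    exacts [min_le_left _ _, min_le_right _ _]
  filter_upwards [ae_exists_forall_mem μ F hdisj hcard hp T hT hpT] with J ⟨n, hn⟩
  refine ⟨_, c (2 * n), hnil _, (hc _).2.1 rfl, fun σ hσ => hσ.eq_start_of_strong hN (hF n) (hcard n)
    (fun e he hec => ?_) fun e he hec => ?_⟩
  · have := hn e he
    simp only [T] at this
    rwa [if_pos ⟨n, hec⟩] at this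
  · have := hn e he
    simp only [T] at this
    rw [if_neg] at this
    · exact abs_lt.2 this
    · rintro ⟨m, hm⟩
      have hmn : m ≠ n := by
        rintro rfl
        exact hec hm
      exact Finset.disjoint_left.1 (hdisj hmn) ((hF m e).2 ⟨e.2, Or.inl hm⟩) he

end SpinGlass

/-! ### Existence of ground states. -/

namespace SpinGlass

open Set MeasureTheory

variable {V : Type*} {G : SimpleGraph V}

open scoped Classical in
/-- The configuration obtained from `σ` by flipping the spins in `A`. -/
noncomputable def flip (σ : Configuration V) (A : Set V) : Configuration V :=
  fun x => if x ∈ A then -σ x else σ x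

theorem value_flip_of_mem (J : G.edgeSet → ℝ) (σ : Configuration V) {A : Set V} {e : G.edgeSet}
    (he : e ∈ edgeBoundary G A) : value J (flip σ A) e = - value J σ e := by
  obtain ⟨x, y, h, hx, hy, rfl⟩ := exists_eq_mk_of_mem_edgeBoundary he
  simp [value, flip, hx, hy]

theorem value_flip_of_notMem (J : G.edgeSet → ℝ) (σ : Configuration V) {A : Set V} {e : G.edgeSet}
    (he : e ∉ edgeBoundary G A) : value J (flip σ A) e = value J σ e := by
  obtain ⟨e, hG⟩ := e
  induction e using Sym2.ind with
  | _ x y =>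
    have he' := (mem_edgeBoundary_mk (G := G) hG).not.1 he
    by_cases hx : x ∈ A <;> by_cases hy : y ∈ A <;> simp_all [value, flip]

theorem isClosed_setOf_boundary_nonneg (J : G.edgeSet → ℝ) (hG : ∀ x, (G.neighborSet x).Finite)
    {A : Set V} (hA : A.Finite) :
    IsClosed {σ : Configuration V | 0 ≤ ∑ᶠ e ∈ edgeBoundary G A, value J σ e} := by
  have hfin := finite_edgeBoundary hG hA
  refine isClosed_Ici.preimage (f := fun σ => ∑ᶠ e ∈ edgeBoundary G A, value J σ e) ?_
  simp only [finsum_mem_eq_finite_toFinset_sum _ hfin]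
  refine continuous_finsetSum _ fun e _ => ?_
  obtain ⟨e, he⟩ := e
  induction e using Sym2.ind with
  | _ x y =>
    have h1 : Continuous fun σ : Configuration V => σ x * σ y :=
      (continuous_apply x).mul (continuous_apply y)
    have h2 : Continuous fun s : ℤˣ => J ⟨s(x, y), he⟩ * ((s : ℤ) : ℝ) :=
      continuous_of_discreteTopology
    exact h2.comp h1

/-- In a finite volume the energy has a minimizer. -/
theorem exists_forall_subset_boundary_nonneg (J : G.edgeSet → ℝ)
    (hG : ∀ x, (G.neighborSet x).Finite) (L : Finset V) :
    ∃ σ : Configuration V, ∀ A : Set V, A ⊆ L → 0 ≤ ∑ᶠ e ∈ edgeBoundary G A, value J σ e := by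
  classical
  have hfin : {e : G.edgeSet | ∃ x ∈ L, x ∈ (e : Sym2 V)}.Finite := by
    refine Set.Finite.of_finite_image (f := Subtype.val) ?_ Subtype.val_injective.injOn
    refine (L.finite_toSet.biUnion fun x _ => (hG x).image fun y => s(x, y)).subset ?_
    rintro _ ⟨⟨e, he⟩, ⟨x, hxL, hx⟩, rfl⟩
    obtain ⟨y, rfl⟩ := Sym2.mem_iff_exists.1 hx
    exact mem_biUnion hxL ⟨y, he, rfl⟩
  set E := hfin.toFinset
  -- Fixing the spins outside `L` leaves finitely many candidates and permits every flip within `L`.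
  let S : Set (Configuration V) := {σ | ∀ x ∉ L, σ x = 1}
  have hS : S.Finite := by
    refine Set.Finite.of_finite_image (f := fun σ : Configuration V => fun x : L => σ x)
      (Set.toFinite _) ?_
    intro σ hσ τ hτ h
    ext1 x
    by_cases hx : x ∈ L
    · exact congrFun h ⟨x, hx⟩
    · rw [hσ x hx, hτ x hx]
  obtain ⟨σ, hσS, hσ⟩ := Set.exists_max_image S (fun σ => ∑ e ∈ E, value J σ e) hS
    ⟨fun _ => 1, fun _ _ => rfl⟩
  refine ⟨σ, fun A hA => ?_⟩
  have hsub : edgeBoundary G A ⊆ (E : Set G.edgeSet) := by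
    intro e he
    obtain ⟨x, hx, hxe⟩ := he.1
    exact hfin.mem_toFinset.2 ⟨x, hA hx, hxe⟩
  have hflip : flip σ A ∈ S := fun x hx => by
    have : x ∉ A := fun h => hx (hA h)
    simp [flip, this, hσS x hx]
  have h1 := hσ _ hflip
  have hB : ((E.filter (· ∈ edgeBoundary G A) : Finset G.edgeSet) : Set G.edgeSet) =
      edgeBoundary G A := by
    ext e
    simpa using fun h => hsub h
  rw [← hB, finsum_mem_coe_finset]
  -- The flip negates the boundary terms and keeps the rest, so maximality says that the boundary
  -- sum is at least its own negative.
  rw [← Finset.sum_filter_add_sum_filter_not E (· ∈ edgeBoundary G A),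
    ← Finset.sum_filter_add_sum_filter_not E (· ∈ edgeBoundary G A) (fun e => value J σ e),
    Finset.sum_congr rfl fun e he => value_flip_of_mem J σ (Finset.mem_filter.1 he).2,
    Finset.sum_congr rfl fun e he => value_flip_of_notMem J σ (Finset.mem_filter.1 he).2,
    Finset.sum_neg_distrib] at h1
  linarith

/-- Ground states exist on every graph of finite degrees. -/
theorem exists_isGroundState (J : G.edgeSet → ℝ) (hG : ∀ x, (G.neighborSet x).Finite) :
    ∃ σ, IsGroundState G J σ := by
  classical
  let K : Finset V → Set (Configuration V) := fun L =>
    ⋂ A ∈ {A : Set V | A ⊆ L}, {σ | 0 ≤ ∑ᶠ e ∈ edgeBoundary G A, value J σ e}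
  have hclosed : ∀ L, IsClosed (K L) := fun L => isClosed_biInter fun A hA =>
    isClosed_setOf_boundary_nonneg J hG (L.finite_toSet.subset hA)
  -- The sets `K L` are nonempty, closed and decreasing in `L` in a compact space.
  have hne : (⋂ L, K L).Nonempty := by
    refine IsCompact.nonempty_iInter_of_directed_nonempty_isCompact_isClosed K ?_ (fun L => ?_)
      (fun L => (hclosed L).isCompact) hclosed
    · have hanti : Antitone K := fun L M h =>
        biInter_subset_biInter_left fun A (hA : A ⊆ L) => hA.trans (by exact_mod_cast h)
      exact hanti.directed_ge
    · obtain ⟨σ, hσ⟩ := exists_forall_subset_boundary_nonneg J hG L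
      exact ⟨σ, mem_iInter₂.2 hσ⟩
  obtain ⟨σ, hσ⟩ := hne
  exact ⟨σ, fun A hA => mem_iInter₂.1 (mem_iInter.1 hσ hA.toFinset) A (by simp)⟩

end SpinGlass

theorem mainTheorem7 {V : Type*} (G : SimpleGraph V) (hG : G.Connected)
    (φ : SpinGlass.PlaneEmbedding G) (hφ : SpinGlass.IsChoked φ)
    (μ : MeasureTheory.Measure ℝ) [MeasureTheory.IsProbabilityMeasure μ]
    [MeasureTheory.NullSingletonClass μ] [μ.IsOpenPosMeasure] [μ.IsNegInvariant] :
    ∀ᵐ J ∂(MeasureTheory.Measure.infinitePi (fun _ : G.edgeSet => μ)),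
      ∃! p : Set (SpinGlass.Configuration V), SpinGlass.IsGroundStatePair G J p := by
  classical
  -- Countability of vertices and edges allows the almost sure statements to hold simultaneously for
  -- all vertices and all finite edge sets.
  have hV : Countable V := hφ.1.countable
  have hV2 : Countable (Sym2 V) := (Quot.mk_surjective (r := Sym2.Rel V)).countable
  have hfin := hφ.finite_neighborSet
  filter_upwards [SpinGlass.ae_isNonresonant μ,
    MeasureTheory.ae_all_iff.2 fun v => hφ.ae_exists_strong μ v] with J hJ hc
  obtain ⟨σ, hσ⟩ := SpinGlass.exists_isGroundState J hfin
  refine ⟨{σ, -σ}, ⟨σ, hσ, rfl⟩, ?_⟩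
  rintro _ ⟨τ, hτ, rfl⟩
  rcases hσ.eq_or_eq_neg hG hφ.1 hfin hJ hc hτ with rfl | rfl
  · rfl
  · rw [neg_neg, Set.pair_comm]
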